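/- Graphs are undirected, without multiple edges; loops are allowed unless excluded. For graphs $T$ and $H$, let $\mathrm{Hom}(T,H)$ be the polyhedral complex whose cells are indexed by the functions $\eta:V(T)\to 2^{V(H)}\setminus\{\emptyset\}$ such that $(x,y)\in E(T)$, $\tilde x\in\eta(x)$ and $\tilde y\in\eta(y)$ imply $(\tilde x,\tilde y)\in E(H)$, the closure of the cell $\eta$ consisting of all cells $\tilde\eta$ with $\tilde\eta(v)\subseteq\eta(v)$ for all $v\in V(T)$; equivalently, up to barycentric subdivision, $\mathrm{Hom}(T,H)$ is the geometric realization of the poset of all such $\eta$, ordered by pointwise inclusion. A $\mathbb Z_2$-action on $T$, given by an involutive graph homomorphism $\gamma:T\to T$, induces the involution $\eta\mapsto\eta\circ\gamma$ on $\mathrm{Hom}(T,H)$. The action flips an edge if there are $a\neq b$ in $V(T)$ with $(a,b)\in E(T)$ and $\gamma(a)=b$; in this case the induced $\mathbb Z_2$-action on $\mathrm{Hom}(T,H)$ is free for every $H$ without loops. For a CW complex $X$ with a free $\mathbb Z_2$-action there is a $\mathbb Z_2$-map $X\to S^\infty$, where $\mathbb Z_2$ acts antipodally on $S^\infty$, and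 the induced map $w:X/\mathbb Z_2\to\mathbb{RP}^\infty$ is unique up to homotopy. Let $z$ be the nontrivial class in $H^1(\mathbb{RP}^\infty;\mathbb Z_2)$, let $\varpi_1(X)=w^*(z)\in H^1(X/\mathbb Z_2;\mathbb Z_2)$ be the first Stiefel–Whitney class of $X$, and let $\varpi_1^k(X)\in H^k(X/\mathbb Z_2;\mathbb Z_2)$ be its $k$-th cup power, where $\varpi_1^0(X)=1$. **Theorem 2.1.** Let $G$ be a graph without loops, and let $T$ be a graph with a $\mathbb Z_2$-action that flips some edge of $T$. If for some integers $k\ge 0$ and $m\ge 1$ we have $\varpi_1^k(\mathrm{Hom}(T,G))\neq 0$ and $\varpi_1^k(\mathrm{Hom}(T,K_m))=0$, where $K_m$ is the complete graph on $m$ vertices, then $\chi(G)\ge m+1$. -/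

import Mathlib

open CategoryTheory

universe u v

/-! ### Singular cohomology with coefficients in `ℤ/2`, and the cup product -/

namespace SingF2

/-- Singular `n`-simplices of `X`: continuous maps from the standard topological `n`-simplex. -/
abbrev Simplex (n : ℕ) (X : Type*) [TopologicalSpace X] : Type _ :=
  C(stdSimplex ℝ (Fin (n + 1)), X)

/-- The affine map of standard simplices that is given by `f` on vertices. -/
noncomputable def affineMap {p n : ℕ} (f : Fin (p + 1) → Fin (n + 1)) :
    C(stdSimplex ℝ (Fin (p + 1)), stdSimplex ℝ (Fin (n + 1))) :=
  ⟨stdSimplex.map f, stdSimplex.continuous_map f⟩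

lemma affineMap_comp {p n l : ℕ} (g : Fin (n + 1) → Fin (l + 1)) (f : Fin (p + 1) → Fin (n + 1)) :
    (affineMap g).comp (affineMap f) = affineMap (g ∘ f) := by
  ext1 x
  exact stdSimplex.map_comp_apply f g x

variable {X Y : Type*} [TopologicalSpace X] [TopologicalSpace Y]

/-- The simplex of `X` obtained from `σ` by precomposition with an affine map. -/
noncomputable def Simplex.pull {p n : ℕ} (σ : Simplex n X) (f : Fin (p + 1) → Fin (n + 1)) :
    Simplex p X :=
  σ.comp (affineMap f)

lemma Simplex.pull_pull {p n l : ℕ} (σ : Simplex l X) (g : Fin (n + 1) → Fin (l + 1))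
    (f : Fin (p + 1) → Fin (n + 1)) : (σ.pull g).pull f = σ.pull (g ∘ f) := by
  unfold Simplex.pull
  rw [ContinuousMap.comp_assoc, affineMap_comp]

/-- Singular `n`-cochains with coefficients in `ℤ/2`. -/
abbrev Cochain (n : ℕ) (X : Type*) [TopologicalSpace X] : Type _ :=
  Simplex n X → ZMod 2

/-- The coboundary: `(δ c)(σ)` is the sum of the values of `c` on the faces of `σ`
(signs are irrelevant modulo `2`). -/
noncomputable def coboundary (n : ℕ) (X : Type*) [TopologicalSpace X] :
    Cochain n X →ₗ[ZMod 2] Cochain (n + 1) X where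
  toFun c σ := ∑ i : Fin (n + 2), c (σ.pull (Fin.succAbove i))
  map_add' c d := by
    funext σ
    simp [Finset.sum_add_distrib]
  map_smul' a c := by
    funext σ
    simp [Finset.mul_sum]

/-- The cocycles of degree `n`. -/
noncomputable def cocycles (n : ℕ) (X : Type*) [TopologicalSpace X] :
    Submodule (ZMod 2) (Cochain n X) :=
  LinearMap.ker (coboundary n X)

/-- The coboundaries of degree `n`; there are none in degree `0` except zero. -/
noncomputable def coboundaries : (n : ℕ) → (X : Type*) → [TopologicalSpace X] →
    Submodule (ZMod 2) (Cochain n X)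
  | 0, _, _ => ⊥
  | n + 1, X, _ => LinearMap.range (coboundary n X)

/-- The singular cohomology group `Hⁿ(X; ℤ/2)`: cocycles modulo coboundaries. -/
abbrev Cohomology (n : ℕ) (X : Type*) [TopologicalSpace X] : Type _ :=
  cocycles n X ⧸ (coboundaries n X).comap (cocycles n X).subtype

/-- The map induced on cochains by a continuous map. -/
noncomputable def Cochain.map (n : ℕ) (f : C(X, Y)) :
    Cochain n Y →ₗ[ZMod 2] Cochain n X where
  toFun c σ := c (f.comp σ)
  map_add' _ _ := rfl
  map_smul' _ _ := rfl

lemma Cochain.coboundary_map (n : ℕ) (f : C(X, Y)) (c : Cochain n Y) :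
    coboundary n X (Cochain.map n f c) = Cochain.map (n + 1) f (coboundary n Y c) := rfl

lemma Cochain.map_mem_cocycles (n : ℕ) (f : C(X, Y)) {c : Cochain n Y}
    (hc : c ∈ cocycles n Y) : Cochain.map n f c ∈ cocycles n X := by
  have hc' : coboundary n Y c = 0 := hc
  change coboundary n X (Cochain.map n f c) = 0
  rw [Cochain.coboundary_map, hc', map_zero]

lemma Cochain.map_mem_coboundaries (n : ℕ) (f : C(X, Y)) {c : Cochain n Y}
    (hc : c ∈ coboundaries n Y) : Cochain.map n f c ∈ coboundaries n X := by
  cases n with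
  | zero =>
    have hc' : c = 0 := hc
    rw [hc', map_zero]
    exact Submodule.zero_mem _
  | succ n =>
    obtain ⟨d, rfl⟩ := hc
    exact ⟨Cochain.map n f d, Cochain.coboundary_map n f d⟩

/-- The map `f^* : Hⁿ(Y; ℤ/2) → Hⁿ(X; ℤ/2)` induced by a continuous map `f : X → Y`. -/
noncomputable def Cohomology.map (n : ℕ) (f : C(X, Y)) :
    Cohomology n Y →ₗ[ZMod 2] Cohomology n X :=
  Submodule.mapQ _ _
    ((Cochain.map n f).restrict (fun _ hc => Cochain.map_mem_cocycles n f hc))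
    (fun _ hc => Cochain.map_mem_coboundaries n f hc)

/-- The front face `[v₀, …, v_p]` of `[v₀, …, v_n]`. -/
def front {p n : ℕ} (h : p ≤ n) (i : Fin (p + 1)) : Fin (n + 1) := ⟨i, by omega⟩

/-- The back face `[v_p, …, v_n]` of `[v₀, …, v_n]`, where `p + q = n`. -/
def back {p q n : ℕ} (h : p + q = n) (i : Fin (q + 1)) : Fin (n + 1) := ⟨p + i, by omega⟩

/-- The Alexander–Whitney cup product of cochains. -/
noncomputable def Cochain.cup {p q n : ℕ} (h : p + q = n) (c : Cochain p X) (d : Cochain q X) :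
    Cochain n X :=
  fun σ => c (σ.pull (front (by omega : p ≤ n))) * d (σ.pull (back h))

/-- The Leibniz rule modulo `2`. -/
lemma Cochain.coboundary_cup {p q n : ℕ} (h : p + q = n) (c : Cochain p X) (d : Cochain q X) :
    coboundary n X (Cochain.cup h c d) =
      Cochain.cup (by omega : (p + 1) + q = n + 1) (coboundary p X c) d +
      Cochain.cup (by omega : p + (q + 1) = n + 1) c (coboundary q X d) := by
  subst h
  funext σ
  -- the terms of the three sums
  have hL : coboundary (p + q) X (Cochain.cup rfl c d) σ =
      ∑ i : Fin (p + q + 2),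
        c (σ.pull (Fin.succAbove i ∘ front (by omega))) *
        d (σ.pull (Fin.succAbove i ∘ back rfl)) := by
    simp only [coboundary, Cochain.cup, LinearMap.coe_mk, AddHom.coe_mk, Simplex.pull_pull]
  have h1 : Cochain.cup (by omega : (p + 1) + q = p + q + 1) (coboundary p X c) d σ =
      ∑ i : Fin (p + 2), c (σ.pull (front (by omega) ∘ Fin.succAbove i)) *
        d (σ.pull (back (by omega : (p + 1) + q = p + q + 1))) := by
    simp only [coboundary, Cochain.cup, LinearMap.coe_mk, AddHom.coe_mk, Simplex.pull_pull,
      Finset.sum_mul]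
  have h2 : Cochain.cup (by omega : p + (q + 1) = p + q + 1) c (coboundary q X d) σ =
      ∑ j : Fin (q + 2), c (σ.pull (front (by omega))) *
        d (σ.pull (back (by omega : p + (q + 1) = p + q + 1) ∘ Fin.succAbove j)) := by
    simp only [coboundary, Cochain.cup, LinearMap.coe_mk, AddHom.coe_mk, Simplex.pull_pull,
      Finset.mul_sum]
  rw [Pi.add_apply, hL, h1, h2, Fin.sum_univ_castSucc (n := p + 1), Fin.sum_univ_succ (n := q + 1),
    ← Fin.sum_congr' _ (by omega : (p + 1) + (q + 1) = p + q + 2), Fin.sum_univ_add]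
  -- the last term of the first sum equals the first term of the second
  have e : c (σ.pull (front (by omega) ∘ Fin.succAbove (Fin.last (p + 1)))) *
        d (σ.pull (back (by omega : (p + 1) + q = p + q + 1))) =
      c (σ.pull (front (by omega))) *
        d (σ.pull (back (by omega : p + (q + 1) = p + q + 1) ∘ Fin.succAbove 0)) := by
    congr 3
    · funext i
      simp [front]
    · funext i
      simp [back, Fin.ext_iff]
      omega
  have e1 : ∀ i : Fin (p + 1),
      c (σ.pull (Fin.succAbove (Fin.cast (by omega) (Fin.castAdd (q + 1) i) : Fin (p + q + 2)) ∘
        front (by omega))) *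
        d (σ.pull (Fin.succAbove (Fin.cast (by omega) (Fin.castAdd (q + 1) i) : Fin (p + q + 2)) ∘
          back rfl)) =
      c (σ.pull (front (by omega) ∘ Fin.succAbove i.castSucc)) *
        d (σ.pull (back (by omega : (p + 1) + q = p + q + 1))) := by
    intro i
    congr 3
    · funext j
      simp only [front, Fin.ext_iff, Fin.succAbove, Function.comp, Fin.lt_def]
      simp only [Fin.val_castSucc, Fin.val_cast, Fin.val_castAdd]
      split_ifs <;> simp
    · funext j
      have := i.2
      simp only [back, Fin.ext_iff, Fin.succAbove, Function.comp, Fin.lt_def]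
      simp only [Fin.val_castSucc, Fin.val_cast, Fin.val_castAdd]
      split_ifs <;> simp <;> omega
  have e2 : ∀ j : Fin (q + 1),
      c (σ.pull (Fin.succAbove (Fin.cast (by omega) (Fin.natAdd (p + 1) j) : Fin (p + q + 2)) ∘
        front (by omega))) *
        d (σ.pull (Fin.succAbove (Fin.cast (by omega) (Fin.natAdd (p + 1) j) : Fin (p + q + 2)) ∘
          back rfl)) =
      c (σ.pull (front (by omega))) *
        d (σ.pull (back (by omega : p + (q + 1) = p + q + 1) ∘ Fin.succAbove j.succ)) := by
    intro i
    congr 3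
    · funext j
      have := j.2
      simp only [front, Fin.ext_iff, Fin.succAbove, Function.comp, Fin.lt_def]
      simp only [Fin.val_castSucc, Fin.val_cast, Fin.val_natAdd]
      split_ifs <;> simp <;> omega
    · funext j
      simp only [back, Fin.ext_iff, Fin.succAbove, Function.comp, Fin.lt_def]
      simp only [Fin.val_castSucc, Fin.val_cast, Fin.val_natAdd, Fin.val_succ]
      split_ifs <;> simp <;> omega
  rw [Finset.sum_congr rfl (fun i _ => e1 i), Finset.sum_congr rfl (fun j _ => e2 j), e]
  have two : ∀ a b x : ZMod 2, a + b = (a + x) + (x + b) := by decide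
  exact two _ _ _

/-- The cup product of a cocycle with a cocycle is a cocycle. -/
lemma Cochain.cup_mem_cocycles {p q n : ℕ} (h : p + q = n) {c : Cochain p X} {d : Cochain q X}
    (hc : c ∈ cocycles p X) (hd : d ∈ cocycles q X) : Cochain.cup h c d ∈ cocycles n X := by
  have hc' : coboundary p X c = 0 := hc
  have hd' : coboundary q X d = 0 := hd
  change coboundary n X _ = 0
  rw [Cochain.coboundary_cup, hc', hd']
  funext σ
  simp [Cochain.cup]

lemma Cochain.cup_mem_coboundaries_left {p q n : ℕ} (h : p + q = n) {c : Cochain p X}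
    {d : Cochain q X} (hc : c ∈ coboundaries p X) (hd : d ∈ cocycles q X) :
    Cochain.cup h c d ∈ coboundaries n X := by
  have hd' : coboundary q X d = 0 := hd
  cases p with
  | zero =>
    have hc' : c = 0 := hc
    have h0 : Cochain.cup h c d = 0 := by
      funext σ
      simp [Cochain.cup, hc']
    rw [h0]
    exact Submodule.zero_mem _
  | succ p =>
    obtain ⟨b, rfl⟩ := hc
    obtain rfl : n = (p + q) + 1 := by omega
    refine ⟨Cochain.cup rfl b d, ?_⟩
    rw [Cochain.coboundary_cup, hd']
    funext σ
    simp [Cochain.cup]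

lemma Cochain.cup_mem_coboundaries_right {p q n : ℕ} (h : p + q = n) {c : Cochain p X}
    {d : Cochain q X} (hc : c ∈ cocycles p X) (hd : d ∈ coboundaries q X) :
    Cochain.cup h c d ∈ coboundaries n X := by
  have hc' : coboundary p X c = 0 := hc
  cases q with
  | zero =>
    have hd' : d = 0 := hd
    have h0 : Cochain.cup h c d = 0 := by
      funext σ
      simp [Cochain.cup, hd']
    rw [h0]
    exact Submodule.zero_mem _
  | succ q =>
    obtain ⟨b, rfl⟩ := hd
    obtain rfl : n = (p + q) + 1 := by omega
    refine ⟨Cochain.cup rfl c b, ?_⟩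
    rw [Cochain.coboundary_cup, hc']
    funext σ
    simp [Cochain.cup]

/-- The cup product `H^p(X; ℤ/2) × H^q(X; ℤ/2) → H^n(X; ℤ/2)`, where `p + q = n`. -/
noncomputable def Cohomology.cup {p q n : ℕ} (h : p + q = n) (α : Cohomology p X)
    (β : Cohomology q X) : Cohomology n X :=
  Quotient.liftOn₂' α β
    (fun c d => Submodule.Quotient.mk
      ⟨Cochain.cup h c.1 d.1, Cochain.cup_mem_cocycles h c.2 d.2⟩)
    (by
      intro c d c' d' hc hd
      rw [Submodule.quotientRel_def] at hc hd
      rw [Submodule.Quotient.eq]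
      change Cochain.cup h c.1 d.1 - Cochain.cup h c'.1 d'.1 ∈ coboundaries n X
      have e : Cochain.cup h c.1 d.1 - Cochain.cup h c'.1 d'.1 =
          Cochain.cup h (c.1 - c'.1) d.1 + Cochain.cup h c'.1 (d.1 - d'.1) := by
        funext σ
        simp [Cochain.cup]
        ring
      rw [e]
      exact Submodule.add_mem _ (Cochain.cup_mem_coboundaries_left h hc d.2)
        (Cochain.cup_mem_coboundaries_right h c'.2 hd))

/-- The unit `1 ∈ H⁰(X; ℤ/2)`: the class of the constant cochain `1`. -/
noncomputable def Cohomology.one (X : Type*) [TopologicalSpace X] : Cohomology 0 X :=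
  Submodule.Quotient.mk ⟨fun _ => 1, by
    change coboundary 0 X _ = 0
    funext σ
    change ∑ _i : Fin 2, (1 : ZMod 2) = 0
    decide⟩

/-- The `k`-th cup power `αᵏ ∈ Hᵏ(X; ℤ/2)` of a class `α ∈ H¹(X; ℤ/2)`, with `α⁰ = 1`. -/
noncomputable def Cohomology.cupPow (α : Cohomology 1 X) : (k : ℕ) → Cohomology k X
  | 0 => Cohomology.one X
  | k + 1 => Cohomology.cup rfl (Cohomology.cupPow α k) α

end SingF2

/-! ### Spaces with involution, and the first Stiefel–Whitney class -/

/-- A `ℤ/2`-space: a topological space with a continuous involution. -/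
structure Z2Space where
  carrier : Type*
  [top : TopologicalSpace carrier]
  inv : C(carrier, carrier)
  inv_inv : ∀ x, inv (inv x) = x

namespace Z2Space

attribute [instance] Z2Space.top

/-- The orbit relation of the involution. -/
def orbitSetoid (X : Z2Space) : Setoid X.carrier where
  r x y := x = y ∨ X.inv x = y
  iseqv :=
    { refl := fun _ => Or.inl rfl
      symm := by
        rintro x y (rfl | rfl)
        · exact Or.inl rfl
        · exact Or.inr (X.inv_inv x)
      trans := by
        rintro x y z (rfl | rfl) (rfl | rfl)
        · exact Or.inl rfl
        · exact Or.inr rfl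
        · exact Or.inr rfl
        · exact Or.inl (X.inv_inv x).symm }

/-- The orbit space `X / (ℤ/2)`, with the quotient topology. -/
def Orbit (X : Z2Space) : Type _ := Quotient X.orbitSetoid

instance (X : Z2Space) : TopologicalSpace X.Orbit :=
  inferInstanceAs (TopologicalSpace (Quotient X.orbitSetoid))

/-- Continuous equivariant maps (`ℤ/2`-maps). -/
structure Hom (X Y : Z2Space) where
  toMap : C(X.carrier, Y.carrier)
  equivariant : ∀ x, toMap (X.inv x) = Y.inv (toMap x)

/-- The map of orbit spaces induced by a `ℤ/2`-map. -/
def Hom.orbitMap {X Y : Z2Space} (f : Hom X Y) : C(X.Orbit, Y.Orbit) where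
  toFun := Quotient.map (sa := X.orbitSetoid) (sb := Y.orbitSetoid) f.toMap (by
    rintro x y (rfl | rfl)
    · exact Or.inl rfl
    · exact Or.inr (f.equivariant x).symm)
  continuous_toFun := Continuous.quotient_map' f.toMap.continuous _

end Z2Space

/-- The sphere `Sⁿ`, as a subset of the space of real sequences: the unit vectors all of whose
coordinates of index greater than `n` vanish. -/
def finSphere (n : ℕ) : Set (ℕ → ℝ) :=
  {x | (∀ i, n < i → x i = 0) ∧ ∑ i ∈ Finset.range (n + 1), x i ^ 2 = 1}

/-- The infinite sphere `S^∞ = ⋃ₙ Sⁿ`. -/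
def InfSphere : Type := {x : ℕ → ℝ // ∃ n, x ∈ finSphere n}

namespace InfSphere

/-- The inclusion `Sⁿ → S^∞`. -/
def incl (n : ℕ) (x : finSphere n) : InfSphere := ⟨x.1, n, x.2⟩

/-- The topology of the CW complex `S^∞`: the finest one for which all inclusions `Sⁿ → S^∞` are
continuous. -/
instance : TopologicalSpace InfSphere :=
  ⨆ n : ℕ, TopologicalSpace.coinduced (incl n) inferInstance

lemma neg_mem_finSphere {n : ℕ} {x : ℕ → ℝ} (hx : x ∈ finSphere n) : -x ∈ finSphere n :=
  ⟨fun i hi => by simp [hx.1 i hi], by simpa using hx.2⟩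

lemma continuous_incl (n : ℕ) : Continuous (incl n) :=
  continuous_iff_coinduced_le.2 (le_iSup
    (fun n : ℕ => TopologicalSpace.coinduced (incl n) inferInstance) n)

/-- The antipodal map of `S^∞`. -/
def antipode : C(InfSphere, InfSphere) where
  toFun x := ⟨-x.1, x.2.imp fun _ h => neg_mem_finSphere h⟩
  continuous_toFun := by
    refine continuous_iSup_dom.2 fun n => continuous_coinduced_dom.2 ?_
    have h : Continuous fun x : finSphere n =>
        (⟨-x.1, neg_mem_finSphere x.2⟩ : finSphere n) :=
      Continuous.subtype_mk continuous_subtype_val.neg _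
    exact (continuous_incl n).comp h

end InfSphere

/-- `S^∞` with the antipodal involution: the universal free `ℤ/2`-space `E(ℤ/2)`. -/
def antipodalSphere : Z2Space where
  carrier := InfSphere
  inv := InfSphere.antipode
  inv_inv x := Subtype.ext (neg_neg x.1)

/-- Infinite real projective space `ℝP^∞ = B(ℤ/2)`, the orbit space of the antipodal map. -/
abbrev InfProjSpace : Type := antipodalSphere.Orbit

/-- The nontrivial class `z ∈ H¹(ℝP^∞; ℤ/2) ≅ ℤ/2`. -/
noncomputable def projGenerator : SingF2.Cohomology 1 InfProjSpace :=
  Classical.epsilon fun z => z ≠ 0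

open Classical in
/-- The first Stiefel–Whitney class `ϖ₁(X) = w^*(z) ∈ H¹(X / (ℤ/2); ℤ/2)`, where
`w : X / (ℤ/2) → ℝP^∞` is induced by a `ℤ/2`-map `X → S^∞`. Such a `ℤ/2`-map exists for every free
`ℤ/2`-CW-complex `X`, and `w` is then unique up to homotopy. (When there is no such map, so that
the class is not defined, the value is the dummy `0`.) -/
noncomputable def stiefelWhitney (X : Z2Space) : SingF2.Cohomology 1 X.Orbit :=
  if h : Nonempty (X.Hom antipodalSphere) then
    SingF2.Cohomology.map 1 (Classical.choice h).orbitMap projGenerator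
  else 0

/-- The power `ϖ₁ᵏ(X) ∈ Hᵏ(X / (ℤ/2); ℤ/2)`. -/
noncomputable def stiefelWhitneyPow (X : Z2Space) (k : ℕ) : SingF2.Cohomology k X.Orbit :=
  (stiefelWhitney X).cupPow k

/-! ### Graphs and `Hom` complexes -/

/-- An undirected graph without multiple edges, in which loops are allowed. -/
structure LoopGraph (V : Type*) where
  Adj : V → V → Prop
  symm : ∀ x y, Adj x y → Adj y x

/-- A loopless graph, viewed as a graph in which loops are allowed. -/
def SimpleGraph.toLoopGraph {V : Type*} (G : SimpleGraph V) : LoopGraph V where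
  Adj := G.Adj
  symm _ _ h := h.symm

/-- A `ℤ/2`-action on a graph: a graph homomorphism `T → T` that is an involution. -/
structure LoopGraph.Involution {V : Type*} (T : LoopGraph V) where
  toFun : V → V
  map_adj : ∀ x y, T.Adj x y → T.Adj (toFun x) (toFun y)
  invol : ∀ x, toFun (toFun x) = x

/-- The action flips some edge: it interchanges the two ends of an edge that is not a loop. -/
def LoopGraph.Involution.FlipsEdge {V : Type*} {T : LoopGraph V} (γ : T.Involution) : Prop :=
  ∃ a b, a ≠ b ∧ T.Adj a b ∧ γ.toFun a = b

/-- The cells of `Hom(T, H)`: functions `η` from `V(T)` to the nonempty subsets of `V(H)` such that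
for every edge `(x, y)` of `T`, all `x' ∈ η(x)` and `y' ∈ η(y)` are adjacent in `H`. -/
def HomCell {V W : Type*} (T : LoopGraph V) (H : LoopGraph W) : Type _ :=
  {η : V → Set W // (∀ v, (η v).Nonempty) ∧
    ∀ x y, T.Adj x y → ∀ x' ∈ η x, ∀ y' ∈ η y, H.Adj x' y'}

/-- The face poset of `Hom(T, H)`: `η' ≤ η` if and only if `η'(v) ⊆ η(v)` for all `v`. -/
instance {V W : Type*} (T : LoopGraph V) (H : LoopGraph W) : PartialOrder (HomCell T H) :=
  inferInstanceAs (PartialOrder {η : V → Set W // (∀ v, (η v).Nonempty) ∧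
    ∀ x y, T.Adj x y → ∀ x' ∈ η x, ∀ y' ∈ η y, H.Adj x' y'})

/-- The order-preserving map `η ↦ η ∘ γ` of the face poset. -/
def HomCell.act {V W : Type*} {T : LoopGraph V} (γ : T.Involution) (H : LoopGraph W) :
    HomCell T H →o HomCell T H where
  toFun η := ⟨fun v => η.1 (γ.toFun v), fun v => η.2.1 _,
    fun x y h => η.2.2 _ _ (γ.map_adj x y h)⟩
  monotone' _ _ h v := h (γ.toFun v)

/-- The geometric realization of a poset (that is, of the simplicial complex of its chains),
as a functor: the geometric realization of the nerve. -/
noncomputable def posetRealization : PartOrd.{u} ⥤ TopCat.{u} :=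
  PartOrd.nerveFunctor ⋙ SSet.toTop

/-- The space `Hom(T, H)`, in its barycentric subdivision, that is, as the geometric realization of
its face poset; the involution is the one induced by the `ℤ/2`-action on `T`. -/
noncomputable def homComplex {V : Type u} {W : Type v} (T : LoopGraph V) (γ : T.Involution)
    (H : LoopGraph W) : Z2Space.{max u v} where
  carrier := posetRealization.obj (PartOrd.of (HomCell T H))
  inv := (posetRealization.map (PartOrd.ofHom (HomCell.act γ H))).hom
  inv_inv x := by
    have h : PartOrd.ofHom (HomCell.act γ H) ≫ PartOrd.ofHom (HomCell.act γ H) =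
        𝟙 (PartOrd.of (HomCell T H)) := by
      ext η
      refine Subtype.ext (funext fun v => ?_)
      exact congrArg η.1 (γ.invol v)
    have h' := congrArg (fun f => posetRealization.map f) h
    simp only [CategoryTheory.Functor.map_comp, CategoryTheory.Functor.map_id] at h'
    exact congrArg (fun f => f.hom x) h'

/-! Suppose `G` is `m`-colourable. A colouring is a graph homomorphism from `G` to the complete
graph on `m` vertices, and taking images of cells turns it into a `ℤ/2`-map from Hom(T, G) to Hom(T,
K_m) (`exists_homComplex_map`). Powers of the Stiefel–Whitney class pull back along `ℤ/2`-maps, so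
vanishing on the target forces vanishing on the source, against the assumption on `G`.

Since `stiefelWhitney` is defined from a chosen map to S^∞, naturality has two requirements. One is
a map to S^∞ from the target (`exists_homComplex_antipodalSphere`). For a flipped edge (a, b), send
a cell to the difference of the indicators of its values at `a` and `b`: this never vanishes, since
adjacent vertices have disjoint values in a loopless graph, and the involution changes its sign.
Extend linearly over chains and normalize.

The other is independence of the choice (`cohomologyMap_orbitMap_eq`), needed only in degree one. A
1-cocycle of ℝP^∞ becomes the coboundary of a point function `b` on S^∞, because H¹(S^∞) = 0. For
equivariant `f` and `g`, the function b∘f + b∘g descends to the orbit space, where its coboundary is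
the difference of the two pullbacks. -/

namespace SingF2

/-! ### Functoriality of cohomology and of cup powers -/

section Naturality

variable {X Y Z : Type*} [TopologicalSpace X] [TopologicalSpace Y] [TopologicalSpace Z]

lemma Cohomology.map_mk (n : ℕ) (f : C(X, Y)) (c : cocycles n Y) :
    Cohomology.map n f (Submodule.Quotient.mk c) =
      Submodule.Quotient.mk ⟨Cochain.map n f c.1, Cochain.map_mem_cocycles n f c.2⟩ := rfl

lemma Cohomology.map_cup {p q n : ℕ} (h : p + q = n) (f : C(X, Y)) (α : Cohomology p Y)
    (β : Cohomology q Y) :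
    Cohomology.map n f (Cohomology.cup h α β) =
      Cohomology.cup h (Cohomology.map p f α) (Cohomology.map q f β) := by
  obtain ⟨c, rfl⟩ := Submodule.Quotient.mk_surjective _ α
  obtain ⟨d, rfl⟩ := Submodule.Quotient.mk_surjective _ β
  rfl

lemma Cohomology.map_cupPow (f : C(X, Y)) (α : Cohomology 1 Y) (k : ℕ) :
    Cohomology.map k f (α.cupPow k) = (Cohomology.map 1 f α).cupPow k := by
  induction k with
  | zero => rfl
  | succ k ih => rw [Cohomology.cupPow, Cohomology.map_cup, ih, Cohomology.cupPow]

lemma Cohomology.map_map (n : ℕ) (g : C(Y, Z)) (f : C(X, Y)) (α : Cohomology n Z) :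
    Cohomology.map n f (Cohomology.map n g α) = Cohomology.map n (g.comp f) α := by
  obtain ⟨c, rfl⟩ := Submodule.Quotient.mk_surjective _ α
  rfl

end Naturality

/-! ### Cochains of degree at most one and homotopies -/

section Degree1

variable {X Y Z : Type*} [TopologicalSpace X] [TopologicalSpace Y] [TopologicalSpace Z]

lemma affineMap_const {p n : ℕ} (i : Fin (n + 1)) :
    affineMap (fun _ : Fin (p + 1) => i) = ContinuousMap.const _ (stdSimplex.vertex i) := by
  have h : affineMap (fun _ : Fin (p + 1) => i) =
      (affineMap (fun _ : Fin 1 => i)).comp (affineMap (fun _ : Fin (p + 1) => (0 : Fin 1))) := by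
    rw [affineMap_comp]; rfl
  rw [h]
  ext1 x
  have hx : affineMap (fun _ : Fin (p + 1) => (0 : Fin 1)) x = stdSimplex.vertex 0 :=
    Subsingleton.elim _ _
  rw [ContinuousMap.comp_apply, hx]
  exact stdSimplex.map_vertex _ _

/-- The `0`-cochain with prescribed values on points. -/
noncomputable def Cochain.ofPoints (b : X → ZMod 2) : Cochain 0 X :=
  fun σ => b (σ (stdSimplex.vertex 0))

lemma coboundary_ofPoints (b : X → ZMod 2) (σ : Simplex 1 X) :
    coboundary 0 X (Cochain.ofPoints b) σ =
      b (σ (stdSimplex.vertex 1)) + b (σ (stdSimplex.vertex 0)) := by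
  have h (i : Fin 2) : (σ.pull (Fin.succAbove i)) (stdSimplex.vertex (0 : Fin 1)) =
      σ (stdSimplex.vertex (Fin.succAbove i 0)) :=
    congrArg σ (stdSimplex.map_vertex _ _)
  change ∑ i : Fin 2, b ((σ.pull (Fin.succAbove i)) (stdSimplex.vertex (0 : Fin 1))) = _
  rw [Fin.sum_univ_two, h, h]
  rfl

/-- The standard 0-simplex is a single point, so every 0-cochain comes from a function on points. -/
lemma exists_eq_coboundary_ofPoints_of_mem_coboundaries {c : Cochain 1 X}
    (hc : c ∈ coboundaries 1 X) : ∃ b : X → ZMod 2, c = coboundary 0 X (Cochain.ofPoints b) := by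
  obtain ⟨d, rfl⟩ := hc
  refine ⟨fun x => d (ContinuousMap.const _ x), congrArg _ ?_⟩
  funext σ
  refine congrArg d (ContinuousMap.ext fun t => ?_)
  rw [Subsingleton.elim t (stdSimplex.vertex 0)]
  rfl

lemma add_faces_eq_zero {c : Cochain 1 X} (hc : c ∈ cocycles 1 X) (τ : Simplex 2 X) :
    c (τ.pull ![1, 2]) + c (τ.pull ![0, 2]) + c (τ.pull ![0, 1]) = 0 := by
  have h : coboundary 1 X c τ = 0 := congrFun (hc : coboundary 1 X c = 0) τ
  change ∑ i : Fin 3, c (τ.pull (Fin.succAbove i)) = 0 at h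
  rw [Fin.sum_univ_three] at h
  rwa [show (Fin.succAbove 0 : Fin 2 → Fin 3) = ![1, 2] by decide,
    show (Fin.succAbove 1 : Fin 2 → Fin 3) = ![0, 2] by decide,
    show (Fin.succAbove 2 : Fin 2 → Fin 3) = ![0, 1] by decide] at h

/-- The three faces of a constant 2-simplex are one and the same constant 1-simplex, and 3a = a
modulo 2. -/
lemma map_const_eq_zero {c : Cochain 1 Z} (hc : c ∈ cocycles 1 Z) (z : Z) :
    Cochain.map 1 (ContinuousMap.const Y z) c = 0 := by
  funext σ
  have h := add_faces_eq_zero hc (ContinuousMap.const _ z)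
  have h3 : ∀ a : ZMod 2, a + a + a = 0 → a = 0 := by decide
  exact h3 _ h

/-- The restriction of a homotopy to the product of two affine maps. -/
noncomputable def prismFace (H : C(Y × stdSimplex ℝ (Fin 2), Z)) (σ : Simplex 1 Y) {n : ℕ}
    (f g : Fin (n + 1) → Fin 2) : Simplex n Z :=
  H.comp ((σ.comp (affineMap f)).prodMk (affineMap g))

lemma prismFace_pull (H : C(Y × stdSimplex ℝ (Fin 2), Z)) (σ : Simplex 1 Y) {n p : ℕ}
    (f g : Fin (n + 1) → Fin 2) (h : Fin (p + 1) → Fin (n + 1)) :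
    (prismFace H σ f g).pull h = prismFace H σ (f ∘ h) (g ∘ h) := by
  unfold prismFace Simplex.pull
  rw [← affineMap_comp, ← affineMap_comp]
  rfl

/-- The restriction of a homotopy parametrised by the standard `1`-simplex to one of its ends. -/
noncomputable def homotopyEnd (H : C(Y × stdSimplex ℝ (Fin 2), Z)) (i : Fin 2) : C(Y, Z) :=
  H.comp ((ContinuousMap.id Y).prodMk (ContinuousMap.const Y (stdSimplex.vertex i)))

/-- The track of a point under a homotopy parametrised by the standard `1`-simplex. -/
noncomputable def homotopyTrack (H : C(Y × stdSimplex ℝ (Fin 2), Z)) (y : Y) : Simplex 1 Z :=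
  H.comp ((ContinuousMap.const _ y).prodMk (ContinuousMap.id _))

lemma prismFace_horizontal (H : C(Y × stdSimplex ℝ (Fin 2), Z)) (σ : Simplex 1 Y) (i : Fin 2) :
    prismFace H σ id (fun _ : Fin 2 => i) = (homotopyEnd H i).comp σ := by
  ext1 t
  have h1 : affineMap (id : Fin 2 → Fin 2) t = t := stdSimplex.map_id_apply t
  change H (σ (affineMap (id : Fin 2 → Fin 2) t), affineMap (fun _ : Fin 2 => i) t) = _
  rw [h1, affineMap_const]
  rfl

lemma prismFace_vertical (H : C(Y × stdSimplex ℝ (Fin 2), Z)) (σ : Simplex 1 Y) (i : Fin 2) :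
    prismFace H σ (fun _ : Fin 2 => i) id = homotopyTrack H (σ (stdSimplex.vertex i)) := by
  ext1 t
  have h1 : affineMap (id : Fin 2 → Fin 2) t = t := stdSimplex.map_id_apply t
  change H (σ (affineMap (fun _ : Fin 2 => i) t), affineMap (id : Fin 2 → Fin 2) t) = _
  rw [h1, affineMap_const]
  rfl

/-- A homotopy induces a cochain homotopy in degree one. -/
lemma map_homotopyEnd_add {c : Cochain 1 Z} (hc : c ∈ cocycles 1 Z)
    (H : C(Y × stdSimplex ℝ (Fin 2), Z)) :
    Cochain.map 1 (homotopyEnd H 1) c + Cochain.map 1 (homotopyEnd H 0) c =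
      coboundary 0 Y (Cochain.ofPoints fun y => c (homotopyTrack H y)) := by
  funext σ
  -- The square over `σ` is cut into two triangles along its diagonal. In the sum of the two cocycle
  -- relations the diagonal cancels modulo 2, leaving the two ends and the two vertical tracks.
  have h1 := add_faces_eq_zero hc (prismFace H σ ![0, 1, 1] ![0, 0, 1])
  have h2 := add_faces_eq_zero hc (prismFace H σ ![0, 0, 1] ![0, 1, 1])
  simp only [prismFace_pull] at h1 h2
  rw [show (![0, 1, 1] : Fin 3 → Fin 2) ∘ (![1, 2] : Fin 2 → Fin 3) = fun _ => 1 by decide,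
    show (![0, 0, 1] : Fin 3 → Fin 2) ∘ (![1, 2] : Fin 2 → Fin 3) = id by decide,
    show (![0, 1, 1] : Fin 3 → Fin 2) ∘ (![0, 2] : Fin 2 → Fin 3) = id by decide,
    show (![0, 0, 1] : Fin 3 → Fin 2) ∘ (![0, 2] : Fin 2 → Fin 3) = id by decide,
    show (![0, 1, 1] : Fin 3 → Fin 2) ∘ (![0, 1] : Fin 2 → Fin 3) = id by decide,
    show (![0, 0, 1] : Fin 3 → Fin 2) ∘ (![0, 1] : Fin 2 → Fin 3) = fun _ => 0 by decide,
    prismFace_horizontal, prismFace_vertical] at h1 h2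
  rw [coboundary_ofPoints]
  change c ((homotopyEnd H 1).comp σ) + c ((homotopyEnd H 0).comp σ) = _
  generalize c (homotopyTrack H (σ (stdSimplex.vertex 1))) = a1 at *
  generalize c (homotopyTrack H (σ (stdSimplex.vertex 0))) = a0 at *
  generalize c ((homotopyEnd H 1).comp σ) = e1 at *
  generalize c ((homotopyEnd H 0).comp σ) = e0 at *
  generalize c (prismFace H σ id id) = d at *
  revert a1 a0 e1 e0 d
  decide

end Degree1

end SingF2

/-! ### Contractibility of S^∞ -/

namespace InfSphere

open SingF2

/-- The `i`-th coordinate of a point of `S^∞`. -/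
def coord (i : ℕ) (x : InfSphere) : ℝ := x.1 i

lemma continuous_iff {Z : Type*} [TopologicalSpace Z] {f : InfSphere → Z} :
    Continuous f ↔ ∀ n, Continuous fun x : finSphere n => f (incl n x) := by
  refine continuous_iSup_dom.trans (forall_congr' fun n => ?_)
  exact continuous_coinduced_dom

lemma continuous_coord (i : ℕ) : Continuous (coord i) :=
  continuous_iff.2 fun _ => (continuous_apply i).comp continuous_subtype_val

/-- The topology of S^∞ is a colimit, and for locally compact `K` the product with `K` respects it:
curry, test continuity on each Sⁿ, and uncurry. -/
lemma continuous_of_forall_incl_prod {K Z : Type*} [TopologicalSpace K] [LocallyCompactSpace K]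
    [TopologicalSpace Z] {F : InfSphere × K → Z}
    (h : ∀ n, Continuous fun p : finSphere n × K => F (incl n p.1, p.2)) : Continuous F := by
  have hs (x : InfSphere) : Continuous fun k => F (x, k) := by
    obtain ⟨x, n, hx⟩ := x
    exact (h n).comp (Continuous.prodMk_right (⟨x, hx⟩ : finSphere n))
  have hc : Continuous fun x : InfSphere => (⟨fun k => F (x, k), hs x⟩ : C(K, Z)) :=
    continuous_iff.2 fun n => (ContinuousMap.curry ⟨_, h n⟩).continuous
  exact ContinuousMap.continuous_uncurry_of_continuous ⟨_, hc⟩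

lemma ne_zero (x : InfSphere) : x.1 ≠ 0 := by
  obtain ⟨x, n, hx⟩ := x
  rintro rfl
  simpa using hx.2

/-- Rescaling of a finitely supported sequence to unit length. -/
noncomputable def unitSeq (v : ℕ → ℝ) : ℕ → ℝ := fun i => v i / √(∑' j, v j ^ 2)

/-- The point of `S^∞` on the ray through a nonzero finitely supported sequence. -/
noncomputable def normalize (v : ℕ → ℝ) (hv : ∃ n, ∀ i, n < i → v i = 0) (h0 : v ≠ 0) :
    InfSphere :=
  ⟨unitSeq v, by
    obtain ⟨n, hn⟩ := hv
    refine ⟨n, fun i hi => by simp [unitSeq, hn i hi], ?_⟩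
    have hs : ∑' j, v j ^ 2 = ∑ j ∈ Finset.range (n + 1), v j ^ 2 :=
      tsum_eq_sum fun j hj => by
        rw [hn j (by simpa using hj)]; simp
    have hpos : 0 < ∑ j ∈ Finset.range (n + 1), v j ^ 2 := by
      refine Finset.sum_pos' (fun _ _ => sq_nonneg _) ?_
      by_contra! hcon
      refine h0 (funext fun i => ?_)
      by_cases hi : n < i
      · exact hn i hi
      · have := hcon i (Finset.mem_range.2 (by omega))
        exact pow_eq_zero_iff two_ne_zero |>.1 (le_antisymm this (sq_nonneg _))
    simp only [unitSeq, div_pow]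
    rw [← Finset.sum_div, hs, Real.sq_sqrt hpos.le, div_self hpos.ne']⟩

lemma unitSeq_self (x : InfSphere) : unitSeq x.1 = x.1 := by
  obtain ⟨x, n, hx⟩ := x
  have hs : ∑' j, x j ^ 2 = 1 := by
    rw [← hx.2]
    exact tsum_eq_sum fun j hj => by
      rw [hx.1 j (by simpa using hj)]; simp
  funext i
  change x i / √(∑' j, x j ^ 2) = x i
  rw [hs]; simp

lemma normalize_neg {v : ℕ → ℝ} (hv : ∃ n, ∀ i, n < i → v i = 0) (h0 : v ≠ 0) :
    normalize (-v) (hv.imp fun _ h i hi => neg_eq_zero.2 (h i hi)) (neg_ne_zero.2 h0) =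
      antipode (normalize v hv h0) := by
  refine Subtype.ext (funext fun i => ?_)
  change (-v) i / √(∑' j, (-v) j ^ 2) = -(v i / √(∑' j, v j ^ 2))
  simp [neg_div]

/-- The bound `n` is uniform in `z`, so the map factors through Sⁿ and the norm is a finite sum. -/
lemma continuous_normalize {Z : Type*} [TopologicalSpace Z] {g : Z → ℕ → ℝ} (hg : Continuous g)
    {n : ℕ} (hn : ∀ z i, n < i → g z i = 0) (h0 : ∀ z, g z ≠ 0) :
    Continuous fun z => normalize (g z) ⟨n, hn z⟩ (h0 z) := by
  have hs (z : Z) : ∑' j, g z j ^ 2 = ∑ j ∈ Finset.range (n + 1), g z j ^ 2 :=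
    tsum_eq_sum fun j hj => by
      rw [hn z j (by simpa using hj)]; simp
  have hpos (z : Z) : √(∑ j ∈ Finset.range (n + 1), g z j ^ 2) ≠ 0 := by
    refine (Real.sqrt_pos.2 (Finset.sum_pos' (fun _ _ => sq_nonneg _) ?_)).ne'
    by_contra! hcon
    refine h0 z (funext fun i => ?_)
    by_cases hi : n < i
    · exact hn z i hi
    · have := hcon i (Finset.mem_range.2 (by omega))
      exact pow_eq_zero_iff two_ne_zero |>.1 (le_antisymm this (sq_nonneg _))
  have hmem (z : Z) : (normalize (g z) ⟨n, hn z⟩ (h0 z)).1 ∈ finSphere n := by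
    refine ⟨fun i hi => ?_, ?_⟩
    · change g z i / _ = 0
      rw [hn z i hi, zero_div]
    · change ∑ i ∈ Finset.range (n + 1), (g z i / √(∑' j, g z j ^ 2)) ^ 2 = 1
      simp only [div_pow]
      rw [← Finset.sum_div, hs, Real.sq_sqrt (Finset.sum_nonneg fun _ _ => sq_nonneg _),
        div_self fun h => hpos z (by rw [h, Real.sqrt_zero])]
  refine (continuous_incl n).comp (Continuous.subtype_mk (f := fun z =>
    (normalize (g z) ⟨n, hn z⟩ (h0 z)).1) ?_ hmem)
  refine continuous_pi fun i => ?_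
  change Continuous fun z => g z i / √(∑' j, g z j ^ 2)
  simp only [hs]
  have hgi (i : ℕ) : Continuous fun z => g z i := (continuous_apply i).comp hg
  exact (hgi i).div (Real.continuous_sqrt.comp (continuous_finsetSum _ fun j _ => (hgi j).pow 2))
    hpos

/-- The right shift of a sequence, with a given first term. -/
def consSeq (a : ℝ) (x : ℕ → ℝ) : ℕ → ℝ
  | 0 => a
  | i + 1 => x i

lemma continuous_consSeq {Z : Type*} [TopologicalSpace Z] {a : Z → ℝ} {x : Z → ℕ → ℝ}
    (ha : Continuous a) (hx : Continuous x) : Continuous fun z => consSeq (a z) (x z) := by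
  refine continuous_pi fun i => ?_
  cases i with
  | zero => exact ha
  | succ i => exact (continuous_apply i).comp hx

lemma exists_support (x : InfSphere) : ∃ n, ∀ i, n < i → x.1 i = 0 :=
  x.2.imp fun _ h => h.1

lemma consSeq_support {a : ℝ} {x : ℕ → ℝ} {n : ℕ} (hx : ∀ i, n < i → x i = 0) (i : ℕ)
    (hi : n + 1 < i) : consSeq a x i = 0 := by
  cases i with
  | zero => omega
  | succ i => exact hx i (by omega)

/-- If s = 0, only the injective shift remains. Otherwise a zero combination would make the
coordinates of `x` vanish one after another. -/
lemma smul_add_smul_consSeq_ne_zero {x : ℕ → ℝ} (hx : x ≠ 0) {s t : ℝ} (hst : s + t = 1) :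
    s • x + t • consSeq 0 x ≠ 0 := by
  intro h
  have h' (i : ℕ) : s * x i + t * consSeq 0 x i = 0 := congrFun h i
  by_cases hs : s = 0
  · have ht : t = 1 := by linarith
    refine hx (funext fun i => ?_)
    simpa [hs, ht, consSeq] using h' (i + 1)
  · refine hx (funext fun i => ?_)
    induction i with
    | zero => simpa [consSeq, hs] using h' 0
    | succ i ih => simpa [consSeq, hs, ih] using h' (i + 1)

lemma consSeq_smul_ne_zero {x : ℕ → ℝ} (hx : x ≠ 0) {s t : ℝ} (hst : s + t = 1) :
    consSeq t (s • x) ≠ 0 := by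
  intro h
  have ht : t = 0 := congrFun h 0
  have hs : s = 1 := by linarith
  refine hx (funext fun i => ?_)
  simpa [consSeq, hs] using congrFun h (i + 1)

lemma continuous_simplexCoord (i : Fin 2) :
    Continuous fun s : stdSimplex ℝ (Fin 2) => s i :=
  (continuous_apply i).comp continuous_subtype_val

/-- The linear homotopy from the identity of `S^∞` to the shift. -/
noncomputable def shiftHomotopy : C(InfSphere × stdSimplex ℝ (Fin 2), InfSphere) where
  toFun p := normalize (p.2 0 • p.1.1 + p.2 1 • consSeq 0 p.1.1)
    (by
      obtain ⟨n, hn⟩ := exists_support p.1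
      refine ⟨n + 1, fun i hi => ?_⟩
      simp [hn i (by omega), consSeq_support hn i hi])
    (smul_add_smul_consSeq_ne_zero p.1.ne_zero (stdSimplex.add_eq_one p.2))
  continuous_toFun := by
    refine continuous_of_forall_incl_prod fun n => ?_
    have h1 : Continuous fun p : finSphere n × stdSimplex ℝ (Fin 2) => p.1.1 :=
      continuous_subtype_val.comp continuous_fst
    refine continuous_normalize (n := n + 1)
      (g := fun p : finSphere n × stdSimplex ℝ (Fin 2) => p.2 0 • p.1.1 + p.2 1 • consSeq 0 p.1.1)
      ?_ ?_ _
    · exact (((continuous_simplexCoord 0).comp continuous_snd).smul h1).add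
        (((continuous_simplexCoord 1).comp continuous_snd).smul
          (continuous_consSeq continuous_const h1))
    · intro p i hi
      simp [p.1.2.1 i (by omega), consSeq_support p.1.2.1 i hi]

/-- The linear homotopy from the shift to a constant map of `S^∞`. -/
noncomputable def contractHomotopy : C(InfSphere × stdSimplex ℝ (Fin 2), InfSphere) where
  toFun p := normalize (consSeq (p.2 1) (p.2 0 • p.1.1))
    (by
      obtain ⟨n, hn⟩ := exists_support p.1
      exact ⟨n + 1, consSeq_support fun i hi => by simp [hn i hi]⟩)
    (consSeq_smul_ne_zero p.1.ne_zero (stdSimplex.add_eq_one p.2))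
  continuous_toFun := by
    refine continuous_of_forall_incl_prod fun n => ?_
    have h1 : Continuous fun p : finSphere n × stdSimplex ℝ (Fin 2) => p.1.1 :=
      continuous_subtype_val.comp continuous_fst
    refine continuous_normalize (n := n + 1)
      (g := fun p : finSphere n × stdSimplex ℝ (Fin 2) => consSeq (p.2 1) (p.2 0 • p.1.1)) ?_ ?_ ?_
    · exact continuous_consSeq ((continuous_simplexCoord 1).comp continuous_snd)
        (((continuous_simplexCoord 0).comp continuous_snd).smul h1)
    · exact fun p => consSeq_support fun i hi => by simp [p.1.2.1 i hi]

/-- A base point of `S^∞`. -/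
noncomputable def basePoint : InfSphere :=
  normalize (consSeq 1 0) ⟨0, fun i hi => by cases i with
    | zero => omega
    | succ i => rfl⟩ fun h => one_ne_zero (congrFun h 0)

lemma homotopyEnd_shiftHomotopy_zero :
    homotopyEnd shiftHomotopy 0 = ContinuousMap.id InfSphere := by
  ext1 x
  refine Subtype.ext (Eq.trans (congrArg unitSeq ?_) (unitSeq_self x))
  simp

lemma homotopyEnd_shiftHomotopy_one :
    homotopyEnd shiftHomotopy 1 = homotopyEnd contractHomotopy 0 := by
  ext1 x
  refine Subtype.ext (congrArg unitSeq ?_)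
  simp

lemma homotopyEnd_contractHomotopy_one :
    homotopyEnd contractHomotopy 1 = ContinuousMap.const InfSphere basePoint := by
  ext1 x
  refine Subtype.ext (congrArg unitSeq ?_)
  simp

/-- The first cohomology of `S^∞` vanishes. -/
lemma exists_eq_coboundary {c : Cochain 1 InfSphere} (hc : c ∈ cocycles 1 InfSphere) :
    ∃ b : InfSphere → ZMod 2, c = coboundary 0 InfSphere (Cochain.ofPoints b) := by
  -- A straight segment from `x` to the base point may pass through the origin; after the shift it
  -- cannot. Hence the two stages from the identity through the shift to a constant, which express
  -- `c` as a difference of coboundaries.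
  have h1 := map_homotopyEnd_add hc shiftHomotopy
  have h2 := map_homotopyEnd_add hc contractHomotopy
  rw [homotopyEnd_contractHomotopy_one, map_const_eq_zero hc, zero_add] at h2
  rw [homotopyEnd_shiftHomotopy_zero, homotopyEnd_shiftHomotopy_one, h2] at h1
  have h3 := eq_sub_of_add_eq' h1
  rw [← map_sub] at h3
  exact exists_eq_coboundary_ofPoints_of_mem_coboundaries ⟨_, h3.symm⟩

/-- A function on `S^∞` that takes equal values at the ends of every path is constant. -/
lemma eq_of_forall_simplex {α : Type*} (e : InfSphere → α)
    (h : ∀ σ : Simplex 1 InfSphere, e (σ (stdSimplex.vertex 0)) = e (σ (stdSimplex.vertex 1)))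
    (p q : InfSphere) : e p = e q := by
  suffices H : ∀ p, e p = e basePoint from (H p).trans (H q).symm
  intro p
  have h1 : e (homotopyEnd shiftHomotopy 0 p) = e (homotopyEnd shiftHomotopy 1 p) :=
    h (homotopyTrack shiftHomotopy p)
  have h2 : e (homotopyEnd contractHomotopy 0 p) = e (homotopyEnd contractHomotopy 1 p) :=
    h (homotopyTrack contractHomotopy p)
  rw [homotopyEnd_shiftHomotopy_zero, homotopyEnd_shiftHomotopy_one, h2,
    homotopyEnd_contractHomotopy_one] at h1
  exact h1

end InfSphere

/-! ### Orbit spaces, and independence of the map to S^∞ -/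

namespace Z2Space

open SingF2

/-- The projection to the orbit space. -/
def proj (X : Z2Space) : C(X.carrier, X.Orbit) where
  toFun := Quotient.mk X.orbitSetoid
  continuous_toFun := continuous_quotient_mk'

lemma proj_eq_iff {X : Z2Space} {x y : X.carrier} :
    X.proj x = X.proj y ↔ x = y ∨ X.inv x = y :=
  Quotient.eq (r := X.orbitSetoid)

lemma proj_inv (X : Z2Space) (x : X.carrier) : X.proj (X.inv x) = X.proj x :=
  (proj_eq_iff.2 (Or.inr rfl)).symm

lemma proj_surjective (X : Z2Space) : Function.Surjective X.proj :=
  Quotient.mk_surjective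

/-- The composition of two `ℤ/2`-maps. -/
def Hom.comp {X Y Z : Z2Space} (g : Hom Y Z) (f : Hom X Y) : Hom X Z where
  toMap := g.toMap.comp f.toMap
  equivariant x := by
    simp only [ContinuousMap.comp_apply, f.equivariant, g.equivariant]

lemma Hom.orbitMap_comp {X Y Z : Z2Space} (g : Hom Y Z) (f : Hom X Y) :
    (g.comp f).orbitMap = g.orbitMap.comp f.orbitMap := by
  ext1 q
  obtain ⟨x, rfl⟩ := X.proj_surjective q
  rfl

/-- The involution, as an action of the group `{1, -1}`. -/
@[reducible]
def unitsAction (X : Z2Space) : MulAction ℤˣ X.carrier where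
  smul g x := if g = 1 then x else X.inv x
  one_smul x := if_pos rfl
  mul_smul g h x := by
    change (if g * h = 1 then x else X.inv x) =
      if g = 1 then (if h = 1 then x else X.inv x) else X.inv (if h = 1 then x else X.inv x)
    rcases Int.units_eq_one_or g with rfl | rfl <;> rcases Int.units_eq_one_or h with rfl | rfl <;>
      simp [X.inv_inv]

/-- Fix a nonzero coordinate of f(x). The points where it keeps its sign form a neighbourhood of `x`
that is disjoint from its image under the involution, because the involution reverses that sign. -/
lemma isCoveringMap_proj {X : Z2Space} (f : X.Hom antipodalSphere) : IsCoveringMap X.proj := by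
  let := X.unitsAction
  have hneg_smul (x : X.carrier) : (-1 : ℤˣ) • x = X.inv x := if_neg (by decide)
  have : IsQuotientCoveringMap X.proj ℤˣ :=
    { toIsQuotientMap := isQuotientMap_quot_mk
      continuous_const_smul := fun g => by
        rcases Int.units_eq_one_or g with rfl | rfl
        · exact continuous_id
        · exact X.inv.continuous
      apply_eq_iff_mem_orbit := fun {x y} => by
        rw [proj_eq_iff, MulAction.mem_orbit_iff]
        constructor
        · rintro (rfl | rfl)
          · exact ⟨1, one_smul _ _⟩
          · exact ⟨-1, (hneg_smul _).trans (X.inv_inv x)⟩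
        · rintro ⟨g, rfl⟩
          rcases Int.units_eq_one_or g with rfl | rfl
          · exact Or.inl (one_smul _ _)
          · exact Or.inr ((congrArg X.inv (hneg_smul y)).trans (X.inv_inv y))
      disjoint := fun x => by
        obtain ⟨i, hi⟩ := Function.ne_iff.1 (InfSphere.ne_zero (f.toMap x))
        have hc : Continuous fun y => InfSphere.coord i (f.toMap y) * InfSphere.coord i (f.toMap x) :=
          ((InfSphere.continuous_coord i).comp f.toMap.continuous).mul continuous_const
        refine ⟨{y | 0 < InfSphere.coord i (f.toMap y) * InfSphere.coord i (f.toMap x)},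
          (isOpen_lt continuous_const hc).mem_nhds (mul_self_pos.2 hi), fun g => ?_⟩
        rintro ⟨_, ⟨y, hy, rfl⟩, hy'⟩
        rcases Int.units_eq_one_or g with rfl | rfl
        · rfl
        · exfalso
          have hneg : InfSphere.coord i (f.toMap (X.inv y)) = -InfSphere.coord i (f.toMap y) := by
            rw [f.equivariant]; rfl
          have h1 : 0 < InfSphere.coord i (f.toMap y) * InfSphere.coord i (f.toMap x) := hy
          have h2 : 0 < InfSphere.coord i (f.toMap ((-1 : ℤˣ) • y)) *
            InfSphere.coord i (f.toMap x) := hy'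
          rw [hneg_smul, hneg] at h2
          linarith }
  exact this.isCoveringMap

lemma exists_lift_simplex {X : Z2Space} (f : X.Hom antipodalSphere) (σ : Simplex 1 X.Orbit) :
    ∃ τ : Simplex 1 X.carrier, X.proj.comp τ = σ := by
  let φ : C(stdSimplex ℝ (Fin 2), unitInterval) := stdSimplexHomeomorphUnitInterval
  let ψ : C(unitInterval, stdSimplex ℝ (Fin 2)) := stdSimplexHomeomorphUnitInterval.symm
  obtain ⟨x, hx⟩ := X.proj_surjective (σ (ψ 0))
  obtain ⟨Γ, hΓ, -⟩ := (isCoveringMap_proj f).exists_path_lifts (σ.comp ψ) x hx.symm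
  refine ⟨Γ.comp φ, ContinuousMap.ext fun t => ?_⟩
  refine (congrFun hΓ (φ t)).trans ?_
  exact congrArg σ (stdSimplexHomeomorphUnitInterval.symm_apply_apply t)

/-- Any two `ℤ/2`-maps to `S^∞` pull back a class of degree one to the same class. -/
lemma cohomologyMap_orbitMap_eq {X : Z2Space} (f g : X.Hom antipodalSphere)
    (z : Cohomology 1 InfProjSpace) :
    Cohomology.map 1 f.orbitMap z = Cohomology.map 1 g.orbitMap z := by
  obtain ⟨⟨c, hc⟩, rfl⟩ := Submodule.Quotient.mk_surjective _ z
  obtain ⟨b, hb⟩ := InfSphere.exists_eq_coboundary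
    (Cochain.map_mem_cocycles 1 antipodalSphere.proj hc)
  have hb' (σ : Simplex 1 InfSphere) : c (antipodalSphere.proj.comp σ) =
      b (σ (stdSimplex.vertex 1)) + b (σ (stdSimplex.vertex 0)) := by
    rw [← coboundary_ofPoints, ← hb]
    rfl
  -- A path and its antipode have the same projection, hence the same value of `c`, so this function
  -- agrees at both ends of the path.
  have hconst := InfSphere.eq_of_forall_simplex (fun p => b (InfSphere.antipode p) + b p)
    fun σ => by
      have h1 := hb' σ
      have h2 := hb' (InfSphere.antipode.comp σ)
      have h3 : antipodalSphere.proj.comp (InfSphere.antipode.comp σ) =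
          antipodalSphere.proj.comp σ := ContinuousMap.ext fun t => antipodalSphere.proj_inv (σ t)
      rw [h3, h1] at h2
      have aux : ∀ p q r s : ZMod 2, p + q = r + s → s + q = r + p := by decide
      exact aux _ _ _ _ h2
  -- The involution changes both summands by the same constant, so their sum is well defined on
  -- orbits.
  let e : X.Orbit → ZMod 2 := Quotient.lift (s := X.orbitSetoid)
    (fun x => b (f.toMap x) + b (g.toMap x)) (by
      rintro x y (rfl | rfl)
      · rfl
      · have h := hconst (f.toMap x) (g.toMap x)
        change b (f.toMap x) + b (g.toMap x) = b (f.toMap (X.inv x)) + b (g.toMap (X.inv x))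
        rw [f.equivariant, g.equivariant]
        have aux : ∀ p q r s : ZMod 2, p + q = r + s → q + s = p + r := by decide
        exact aux _ _ _ _ h)
  rw [Cohomology.map_mk, Cohomology.map_mk, Submodule.Quotient.eq]
  change Cochain.map 1 f.orbitMap c - Cochain.map 1 g.orbitMap c ∈
    LinearMap.range (coboundary 0 X.Orbit)
  refine ⟨Cochain.ofPoints e, funext fun σ => ?_⟩
  obtain ⟨τ, rfl⟩ := exists_lift_simplex f σ
  rw [coboundary_ofPoints]
  have hf : c (f.orbitMap.comp (X.proj.comp τ)) = _ := hb' (f.toMap.comp τ)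
  have hg : c (g.orbitMap.comp (X.proj.comp τ)) = _ := hb' (g.toMap.comp τ)
  change _ = c (f.orbitMap.comp (X.proj.comp τ)) - c (g.orbitMap.comp (X.proj.comp τ))
  rw [hf, hg]
  have aux : ∀ p q r s : ZMod 2, p + q + (r + s) = p + r - (q + s) := by decide
  exact aux _ _ _ _

end Z2Space

open Z2Space SingF2

/-- Frees the class from the choice in its definition: any `ℤ/2`-map to S^∞ computes it. -/
lemma stiefelWhitney_eq {X : Z2Space} (w : X.Hom antipodalSphere) :
    stiefelWhitney X = Cohomology.map 1 w.orbitMap projGenerator := by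
  rw [stiefelWhitney, dif_pos ⟨w⟩]
  exact cohomologyMap_orbitMap_eq _ _ _

/-- The Stiefel–Whitney class is natural, on spaces over `S^∞`. -/
lemma map_stiefelWhitneyPow {X Y : Z2Space} (f : X.Hom Y) (w : Y.Hom antipodalSphere) (k : ℕ) :
    Cohomology.map k f.orbitMap (stiefelWhitneyPow Y k) = stiefelWhitneyPow X k := by
  rw [stiefelWhitneyPow, stiefelWhitneyPow, Cohomology.map_cupPow, stiefelWhitney_eq w,
    stiefelWhitney_eq (w.comp f), Cohomology.map_map, Hom.orbitMap_comp]

/-! ### Maps out of the realization of a poset -/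

namespace posetRealization

open Opposite Simplicial

section Simplices

variable {P : Type u} [PartialOrder P]

/-- The simplex of the realization of a poset spanned by a chain. -/
noncomputable def simplexMap {n : ℕ} (c : Fin (n + 1) →o P) :
    C(stdSimplex ℝ (Fin (n + 1)), posetRealization.obj (PartOrd.of P)) :=
  TopCat.toSSetObjEquiv _ (op ⦋n⦌)
    ((sSetTopAdj.unit.app (PartOrd.nerveFunctor.obj (PartOrd.of P))).app (op ⦋n⦌)
      c.monotone.functor)

lemma simplexMap_comp {m n : ℕ} (c : Fin (n + 1) →o P) (f : Fin (m + 1) →o Fin (n + 1)) :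
    simplexMap (c.comp f) = (simplexMap c).comp (SingF2.affineMap f) := by
  have h := ConcreteCategory.congr_hom
    ((sSetTopAdj.unit.app (PartOrd.nerveFunctor.obj (PartOrd.of P))).naturality
      (SimplexCategory.mkHom f).op) c.monotone.functor
  exact congrArg (TopCat.toSSetObjEquiv _ (op ⦋m⦌)) h

lemma map_comp_simplexMap {P' : Type u} [PartialOrder P'] (g : P →o P') {n : ℕ}
    (c : Fin (n + 1) →o P) :
    (posetRealization.map (PartOrd.ofHom g)).hom.comp (simplexMap c) = simplexMap (g.comp c) := by
  have h := ConcreteCategory.congr_hom (NatTrans.congr_app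
    (sSetTopAdj.unit.naturality (PartOrd.nerveFunctor.map (PartOrd.ofHom g))) (op ⦋n⦌))
      c.monotone.functor
  exact (congrArg (TopCat.toSSetObjEquiv _ (op ⦋n⦌)) h).symm

/-- Realization is left adjoint to the singular functor, and the adjunct of a map records its
composites with the simplices of chains. -/
lemma hom_ext {Y : TopCat.{u}} {f g : SSet.toTop.obj (PartOrd.nerveFunctor.obj (PartOrd.of P)) ⟶ Y}
    (h : ∀ n (c : Fin (n + 1) →o P), f.hom.comp (simplexMap c) = g.hom.comp (simplexMap c)) :
    f = g := by
  refine (sSetTopAdj.homEquiv _ _).injective ?_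
  rw [Adjunction.homEquiv_unit, Adjunction.homEquiv_unit]
  ext ⟨n⟩ c
  induction n using SimplexCategory.rec with | _ n =>
  exact (TopCat.toSSetObjEquiv _ (op ⦋n⦌)).injective (h n c.toOrderHom)

/-- The simplices of the realization of a poset cover it. -/
lemma exists_simplexMap_eq (x : posetRealization.obj (PartOrd.of P)) :
    ∃ (n : ℕ) (c : Fin (n + 1) →o P) (t : stdSimplex ℝ (Fin (n + 1))), simplexMap c t = x := by
  -- Every predicate is continuous into an indiscrete space. "Lies in some simplex" and "true" agree
  -- on all simplices, hence everywhere by `hom_ext`.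
  let Y : TopCat.{u} := TopCat.trivial.obj (ULift.{u} Prop)
  let f : C(SSet.toTop.obj (PartOrd.nerveFunctor.obj (PartOrd.of P)), Y) :=
    { toFun := fun x => ULift.up (∃ (n : ℕ) (c : Fin (n + 1) →o P)
        (t : stdSimplex ℝ (Fin (n + 1))), simplexMap c t = x)
      continuous_toFun := continuous_top }
  let g : C(SSet.toTop.obj (PartOrd.nerveFunctor.obj (PartOrd.of P)), Y) :=
    { toFun := fun _ => ULift.up True
      continuous_toFun := continuous_top }
  have hfg : TopCat.ofHom f = TopCat.ofHom g := hom_ext fun n c => ContinuousMap.ext fun t =>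
    congrArg ULift.up (eq_true ⟨n, c, t, rfl⟩)
  exact of_eq_true (congrArg ULift.down (ConcreteCategory.congr_hom hfg x))

/-- A compatible family of singular simplices of `Y`, one for each chain of `P`, as a map of
simplicial sets. -/
noncomputable def toSSetMap {Y : Type u} [TopologicalSpace Y]
    (F : ∀ n, (Fin (n + 1) →o P) → C(stdSimplex ℝ (Fin (n + 1)), Y))
    (hF : ∀ m n (f : Fin (m + 1) →o Fin (n + 1)) (c : Fin (n + 1) →o P),
      F m (c.comp f) = (F n c).comp (SingF2.affineMap f)) :
    PartOrd.nerveFunctor.obj (PartOrd.of P) ⟶ TopCat.toSSet.obj (TopCat.of Y) where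
  app n := ↾fun c => ((TopCat.of Y).toSSetObjEquiv n).symm
    (F _ (Functor.toOrderHom (X := Fin (n.unop.len + 1)) (Y := P) c))
  naturality := by
    rintro ⟨n⟩ ⟨m⟩ ⟨f⟩
    ext c
    exact congrArg ((TopCat.of Y).toSSetObjEquiv (op m)).symm
      (hF _ _ f.toOrderHom (Functor.toOrderHom (X := Fin (n.len + 1)) (Y := P) c))

lemma exists_desc_aux {Y : Type u} [TopologicalSpace Y]
    (F : ∀ n, (Fin (n + 1) →o P) → C(stdSimplex ℝ (Fin (n + 1)), Y))
    (hF : ∀ m n (f : Fin (m + 1) →o Fin (n + 1)) (c : Fin (n + 1) →o P),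
      F m (c.comp f) = (F n c).comp (SingF2.affineMap f)) :
    ∃ φ : C(posetRealization.obj (PartOrd.of P), Y),
      ∀ n (c : Fin (n + 1) →o P), φ.comp (simplexMap c) = F n c := by
  refine ⟨((sSetTopAdj.homEquiv _ _).symm (toSSetMap F hF)).hom, fun n c => ?_⟩
  have h := (sSetTopAdj.homEquiv _ _).apply_symm_apply (toSSetMap F hF)
  rw [Adjunction.homEquiv_unit] at h
  exact congrArg (TopCat.toSSetObjEquiv _ (op ⦋n⦌))
    (ConcreteCategory.congr_hom (NatTrans.congr_app h (op ⦋n⦌)) c.monotone.functor)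

end Simplices

/-- A compatible family of singular simplices, one for each chain of `P`, glues to a continuous
map on the realization of `P`. -/
lemma exists_desc {P : Type (max u v)} [PartialOrder P] {Y : Type u} [TopologicalSpace Y]
    (F : ∀ n, (Fin (n + 1) →o P) → C(stdSimplex ℝ (Fin (n + 1)), Y))
    (hF : ∀ m n (f : Fin (m + 1) →o Fin (n + 1)) (c : Fin (n + 1) →o P),
      F m (c.comp f) = (F n c).comp (SingF2.affineMap f)) :
    ∃ φ : C(posetRealization.obj (PartOrd.of P), Y),
      ∀ n (c : Fin (n + 1) →o P) t, φ (simplexMap c t) = F n c t := by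
  -- The adjunction needs `Y` in the universe of `P`.
  obtain ⟨φ, hφ⟩ := exists_desc_aux (Y := ULift.{max u v} Y)
    (fun n c => (⟨ULift.up, continuous_uliftUp⟩ : C(Y, ULift.{max u v} Y)).comp (F n c))
    fun m n f c => by rw [hF]; rfl
  exact ⟨(⟨ULift.down, continuous_uliftDown⟩ : C(ULift.{max u v} Y, Y)).comp φ,
    fun n c t => congrArg ULift.down (DFunLike.congr_fun (hφ n c) t)⟩

end posetRealization

/-! ### Equivariant maps out of Hom complexes -/

section HomComplex

open posetRealization

universe w

lemma homComplex_inv_simplexMap {V : Type u} {W : Type v} {T : LoopGraph V} (γ : T.Involution)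
    (H : LoopGraph W) {n : ℕ} (c : Fin (n + 1) →o HomCell T H) (t : stdSimplex ℝ (Fin (n + 1))) :
    (homComplex T γ H).inv (simplexMap c t) = simplexMap ((HomCell.act γ H).comp c) t :=
  DFunLike.congr_fun (map_comp_simplexMap (HomCell.act γ H) c) t

/-- A family of singular simplices, compatible with faces, degeneracies and the involutions, glues
to a `ℤ/2`-map. -/
lemma exists_hom_of_simplices {V : Type (max u w)} {W : Type v} {T : LoopGraph V}
    (γ : T.Involution) (H : LoopGraph W) (Y : Z2Space.{w})
    (F : ∀ n, (Fin (n + 1) →o HomCell T H) → C(stdSimplex ℝ (Fin (n + 1)), Y.carrier))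
    (hF : ∀ m n (f : Fin (m + 1) →o Fin (n + 1)) (c : Fin (n + 1) →o HomCell T H),
      F m (c.comp f) = (F n c).comp (SingF2.affineMap f))
    (hinv : ∀ n (c : Fin (n + 1) →o HomCell T H) t,
      F n ((HomCell.act γ H).comp c) t = Y.inv (F n c t)) :
    Nonempty ((homComplex T γ H).Hom Y) := by
  obtain ⟨φ, hφ⟩ := exists_desc.{w, max u v} F hF
  refine ⟨⟨φ, fun x => ?_⟩⟩
  obtain ⟨n, c, t, rfl⟩ := exists_simplexMap_eq x
  rw [homComplex_inv_simplexMap]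
  exact (hφ n _ t).trans ((hinv n c t).trans (congrArg Y.inv (hφ n c t).symm))

/-- The map of cells induced by a graph homomorphism of the targets. -/
def HomCell.mapTarget {V W W' : Type*} (T : LoopGraph V) {G : LoopGraph W} {H : LoopGraph W'}
    (φ : W → W') (hφ : ∀ x y, G.Adj x y → H.Adj (φ x) (φ y)) : HomCell T G →o HomCell T H where
  toFun η := ⟨fun v => φ '' η.1 v, fun v => (η.2.1 v).image φ, by
    rintro x y h _ ⟨x', hx, rfl⟩ _ ⟨y', hy, rfl⟩
    exact hφ _ _ (η.2.2 x y h x' hx y' hy)⟩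
  monotone' _ _ h v := Set.image_mono (h v)

/-- A graph homomorphism `G → H` induces a `ℤ/2`-map `Hom(T, G) → Hom(T, H)`. -/
lemma exists_homComplex_map {V : Type u} {W : Type v} {W' : Type} {T : LoopGraph V}
    (γ : T.Involution) {G : LoopGraph W} {H : LoopGraph W'} (φ : W → W')
    (hφ : ∀ x y, G.Adj x y → H.Adj (φ x) (φ y)) :
    Nonempty ((homComplex T γ G).Hom (homComplex T γ H)) := by
  let M : HomCell T G →o HomCell T H := HomCell.mapTarget T φ hφ
  refine exists_hom_of_simplices.{u, v, u} γ G (homComplex T γ H)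
    (fun n c => simplexMap (M.comp c)) (fun k n f c => ?_) (fun n c t => ?_)
  · exact simplexMap_comp (M.comp c) f
  · exact (homComplex_inv_simplexMap γ H (M.comp c) t).symm

variable {V : Type u} {T : LoopGraph V} {m : ℕ} {H : LoopGraph (Fin m)}

/-- The difference of the indicator functions of the values of a cell at `a` and at `b`. -/
noncomputable def HomCell.signVector (a b : V) (η : HomCell T H) (j : ℕ) : ℝ :=
  if h : j < m then (η.1 a).indicator 1 ⟨j, h⟩ - (η.1 b).indicator 1 ⟨j, h⟩ else 0

/-- The linear extension of `HomCell.signVector` to the simplex spanned by a chain. -/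
noncomputable def HomCell.chainVector (a b : V) {n : ℕ} (c : Fin (n + 1) →o HomCell T H)
    (t : stdSimplex ℝ (Fin (n + 1))) (j : ℕ) : ℝ :=
  ∑ i, t i * (c i).signVector a b j

namespace HomCell

lemma chainVector_support (a b : V) {n : ℕ} (c : Fin (n + 1) →o HomCell T H)
    (t : stdSimplex ℝ (Fin (n + 1))) (j : ℕ) (hj : m < j) : chainVector a b c t j = 0 :=
  Finset.sum_eq_zero fun i _ => by simp [signVector, hj.le.not_gt]

/-- A vertex in the value at `a` of the smallest cell stays in the value at `a` along the chain, and
is never in the value at `b`, or it would carry a loop. Its coordinate is therefore the sum of the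
`t i`, which is 1. -/
lemma chainVector_ne_zero {a b : V} (hab : T.Adj a b) (hH : ∀ x, ¬ H.Adj x x) {n : ℕ}
    (c : Fin (n + 1) →o HomCell T H) (t : stdSimplex ℝ (Fin (n + 1))) :
    chainVector a b c t ≠ 0 := by
  obtain ⟨j, hj⟩ := (c 0).2.1 a
  have hja (i : Fin (n + 1)) : j ∈ (c i).1 a := c.monotone (Fin.zero_le i) a hj
  have hjb (i : Fin (n + 1)) : j ∉ (c i).1 b := fun h => hH j ((c i).2.2 a b hab j (hja i) j h)
  intro h
  have h1 : ∑ i, t i * (c i).signVector a b j = 0 := congrFun h j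
  simp [signVector, hja, hjb] at h1

/-- The affine map adds barycentric coordinates over the fibres of `f`, so it suffices to group the
sum by fibres. -/
lemma chainVector_comp (a b : V) {k n : ℕ} (c : Fin (n + 1) →o HomCell T H)
    (f : Fin (k + 1) →o Fin (n + 1)) (t : stdSimplex ℝ (Fin (k + 1))) :
    chainVector a b (c.comp f) t = chainVector a b c (SingF2.affineMap f t) := by
  funext j
  have h (i : Fin (n + 1)) : SingF2.affineMap f t i = ∑ l with f l = i, t l := by
    change stdSimplex.map f t i = _
    rw [stdSimplex.map_coe, FunOnFinite.linearMap_apply_apply]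
  simp only [chainVector, h, Finset.sum_mul]
  rw [← Finset.sum_fiberwise Finset.univ f]
  refine Finset.sum_congr rfl fun i _ => Finset.sum_congr rfl fun l hl => ?_
  rw [← (Finset.mem_filter.1 hl).2]
  rfl

/-- Precomposition with `γ` exchanges the values at `a` and `b`, whose indicators enter with
opposite signs. -/
lemma chainVector_act {a b : V} (γ : T.Involution) (h : γ.toFun a = b) {n : ℕ}
    (c : Fin (n + 1) →o HomCell T H) (t : stdSimplex ℝ (Fin (n + 1))) :
    chainVector a b ((act γ H).comp c) t = -chainVector a b c t := by
  have h' : γ.toFun b = a := by rw [← h, γ.invol]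
  funext j
  rw [Pi.neg_apply, chainVector, chainVector, ← Finset.sum_neg_distrib]
  refine Finset.sum_congr rfl fun i _ => ?_
  have e : (((act γ H).comp c) i).signVector a b j = -(c i).signVector a b j := by
    have ea : (((act γ H).comp c) i).1 a = (c i).1 b := congrArg (c i).1 h
    have eb : (((act γ H).comp c) i).1 b = (c i).1 a := congrArg (c i).1 h'
    rw [signVector, signVector, ea, eb]
    split_ifs <;> simp
  rw [e, mul_neg]

end HomCell

/-- If the involution flips an edge, then `Hom(T, H)` maps equivariantly to `S^∞`, for every
finite loopless `H`. -/
lemma exists_homComplex_antipodalSphere (γ : T.Involution) (hγ : γ.FlipsEdge)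
    (hH : ∀ x, ¬ H.Adj x x) : Nonempty ((homComplex T γ H).Hom antipodalSphere) := by
  obtain ⟨a, b, -, hab, hflip⟩ := hγ
  refine exists_hom_of_simplices.{u, 0, 0} γ H antipodalSphere (fun n c =>
    ⟨fun t => InfSphere.normalize (HomCell.chainVector a b c t)
      ⟨m, HomCell.chainVector_support a b c t⟩ (HomCell.chainVector_ne_zero hab hH c t), ?_⟩)
    (fun k n f c => ?_) (fun n c t => ?_)
  · refine InfSphere.continuous_normalize ?_
      (HomCell.chainVector_support a b c) _
    refine continuous_pi fun j => continuous_finsetSum _ fun i _ => Continuous.mul ?_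
      continuous_const
    exact (continuous_apply i).comp continuous_subtype_val
  · refine ContinuousMap.ext fun t => Subtype.ext ?_
    exact congrArg InfSphere.unitSeq (HomCell.chainVector_comp a b c f t)
  · refine Eq.trans (Subtype.ext ?_) (InfSphere.normalize_neg
      ⟨m, HomCell.chainVector_support a b c t⟩ (HomCell.chainVector_ne_zero hab hH c t))
    exact congrArg InfSphere.unitSeq (HomCell.chainVector_act γ hflip c t)

end HomComplex

/-! ### The bound on the chromatic number -/

theorem theorem2p1 {V : Type u} {W : Type v}
    (G : SimpleGraph W) (T : LoopGraph V) (γ : T.Involution) (hγ : γ.FlipsEdge)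
    (k m : ℕ) (hm : 1 ≤ m)
    (hG : stiefelWhitneyPow (homComplex T γ G.toLoopGraph) k ≠ 0)
    (hK : stiefelWhitneyPow (homComplex T γ (SimpleGraph.completeGraph (Fin m)).toLoopGraph) k = 0) :
    ((m + 1 : ℕ) : ℕ∞) ≤ G.chromaticNumber := by
  by_contra hlt
  have hle : G.chromaticNumber ≤ m := by
    rw [not_le, Nat.cast_add_one] at hlt
    exact Order.le_of_lt_add_one hlt
  obtain ⟨C⟩ := SimpleGraph.chromaticNumber_le_iff_colorable.1 hle
  obtain ⟨f⟩ := exists_homComplex_map γ (G := G.toLoopGraph)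
    (H := (SimpleGraph.completeGraph (Fin m)).toLoopGraph) C fun _ _ h => C.map_adj h
  obtain ⟨w⟩ := exists_homComplex_antipodalSphere γ hγ
    (H := (SimpleGraph.completeGraph (Fin m)).toLoopGraph) fun _ h => h rfl
  exact hG (by rw [← map_stiefelWhitneyPow f w, hK, map_zero])
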